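/- Let $\beta>0$, $d>0$, $\eta>0$, and let $$G(\mathbf t,\mathbf s)=\frac{1}{2\pi}K_0(\beta\|\mathbf t-\mathbf s\|),\qquad \mathbf t=(x,y),\ \mathbf s=(x',y')\in\mathbb R^2,$$ be the free-space Green's function of the modified Helmholtz equation in the plane, where $K_0(z)=\int_0^\infty e^{-z\cosh u}\,du$ $(z>0)$ is the modified Bessel function of the second kind of order zero. All series and integrals below converge absolutely. **Singly periodic case.** Let $\mathbf t,\mathbf s$ lie in the rectangular unit cell $[-\tfrac d2,\tfrac d2]\times[-\tfrac\eta2,\tfrac\eta2]$. Then $$K_1^{west}(\mathbf t,\mathbf s):=\sum_{m=-\infty}^{-2}G(\mathbf t,\mathbf s+(md,0)) =\int_{-\infty}^{\infty}\frac{e^{-\sqrt{\lambda^2+\beta^2}\,(x-x')}}{4\pi\sqrt{\lambda^2+\beta^2}}\,e^{i\lambda(y-y')}\,\frac{e^{-2\sqrt{\lambda^2+\beta^2}\,d}}{1-e^{-\sqrt{\lambda^2+\beta^2}\,d}}\,d\lambda,$$ $$K_1^{east}(\mathbf t,\mathbf s):=\sum_{m=2}^{\infty}G(\mathbf t,\mathbf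 s+(md,0)) =\int_{-\infty}^{\infty}\frac{e^{\sqrt{\lambda^2+\beta^2}\,(x-x')}}{4\pi\sqrt{\lambda^2+\beta^2}}\,e^{i\lambda(y-y')}\,\frac{e^{-2\sqrt{\lambda^2+\beta^2}\,d}}{1-e^{-\sqrt{\lambda^2+\beta^2}\,d}}\,d\lambda.$$ **Doubly periodic case.** Let $\xi\in\mathbb R$ with $d\ge\sqrt{\xi^2+\eta^2}$, put $\hat{\mathbf e}_1=(d,0)$, $\hat{\mathbf e}_2=(\xi,\eta)$, $\mathbf l_{mn}=m\hat{\mathbf e}_1+n\hat{\mathbf e}_2$, and let $\mathbf t,\mathbf s$ lie in the unit cell $\{a\hat{\mathbf e}_1+b\hat{\mathbf e}_2 : a,b\in[-\tfrac12,\tfrac12]\}$. Then $$K_2^{west}(\mathbf t,\mathbf s):=\sum_{n=-1}^{1}\sum_{m=-\infty}^{-4}G(\mathbf t,\mathbf s+\mathbf l_{mn}) =\sum_{n=-1}^{1}\int_{-\infty}^{\infty}\frac{e^{-\sqrt{\lambda^2+\beta^2}\,(x-x'-n\xi)}}{4\pi\sqrt{\lambda^2+\beta^2}}\,e^{i\lambda(y-y'-n\eta)}\,\frac{e^{-4\sqrt{\lambda^2+\beta^2}\,d}}{1-e^{-\sqrt{\lambda^2+\beta^2}\,d}}\,d\lambda,$$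 $$K_2^{east}(\mathbf t,\mathbf s):=\sum_{n=-1}^{1}\sum_{m=4}^{\infty}G(\mathbf t,\mathbf s+\mathbf l_{mn}) =\sum_{n=-1}^{1}\int_{-\infty}^{\infty}\frac{e^{\sqrt{\lambda^2+\beta^2}\,(x-x'-n\xi)}}{4\pi\sqrt{\lambda^2+\beta^2}}\,e^{i\lambda(y-y'-n\eta)}\,\frac{e^{-4\sqrt{\lambda^2+\beta^2}\,d}}{1-e^{-\sqrt{\lambda^2+\beta^2}\,d}}\,d\lambda.$$ -/

import Mathlib

open Real MeasureTheory

noncomputable section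

/-- The modified Bessel function of the second kind of order zero at a real argument `z > 0`,
`K₀(z) = ∫₀^∞ exp (-z cosh u) du`. -/
def besselK0 (z : ℝ) : ℝ :=
  ∫ u in Set.Ioi (0 : ℝ), Real.exp (-(z * Real.cosh u))

/-- The free-space Green's function of the modified Helmholtz equation in the plane,
`G(t, s) = K₀(β ‖t - s‖) / (2π)`. -/
def greenMH (β : ℝ) (t s : EuclideanSpace ℝ (Fin 2)) : ℝ :=
  1 / (2 * π) * besselK0 (β * ‖t - s‖)

/-- The first fundamental translation vector `⟨d, 0⟩`. -/
def latE1 (d : ℝ) : EuclideanSpace ℝ (Fin 2) := !₂[d, 0]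

/-- The second fundamental translation vector `⟨ξ, η⟩`. -/
def latE2 (ξ η : ℝ) : EuclideanSpace ℝ (Fin 2) := !₂[ξ, η]

/-- The lattice vector `l_{mn} = m e₁ + n e₂`. -/
def latVec (d ξ η : ℝ) (m n : ℤ) : EuclideanSpace ℝ (Fin 2) :=
  (m : ℝ) • latE1 d + (n : ℝ) • latE2 ξ η

/-- The closed unit cell, centered at the origin, spanned by `⟨d, 0⟩` and `⟨ξ, η⟩`.
For `ξ = 0` it is the rectangle of dimension `d × η`. -/
def unitCell (d ξ η : ℝ) : Set (EuclideanSpace ℝ (Fin 2)) :=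
  {p | ∃ a ∈ Set.Icc (-(1 / 2) : ℝ) (1 / 2), ∃ b ∈ Set.Icc (-(1 / 2) : ℝ) (1 / 2),
    p = a • latE1 d + b • latE2 ξ η}

/-- The singly periodic west kernel: images of `s` under `m e₁` for all `m ≤ -(m₀ + 1)`. -/
def K1west (m₀ : ℕ) (β d : ℝ) (t s : EuclideanSpace ℝ (Fin 2)) : ℝ :=
  ∑' m : {m : ℤ // m ≤ -((m₀ : ℤ) + 1)}, greenMH β t (s + (m.1 : ℝ) • latE1 d)

/-- The singly periodic east kernel: images of `s` under `m e₁` for all `m ≥ m₀ + 1`. -/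
def K1east (m₀ : ℕ) (β d : ℝ) (t s : EuclideanSpace ℝ (Fin 2)) : ℝ :=
  ∑' m : {m : ℤ // (m₀ : ℤ) + 1 ≤ m}, greenMH β t (s + (m.1 : ℝ) • latE1 d)

/-- The doubly periodic west kernel: images of `s` under `l_{mn}` for `n = -1, 0, 1` and all
`m ≤ -(m₀ + 1)`. -/
def K2west (m₀ : ℕ) (β d ξ η : ℝ) (t s : EuclideanSpace ℝ (Fin 2)) : ℝ :=
  ∑ n ∈ Finset.Icc (-1 : ℤ) 1,
    ∑' m : {m : ℤ // m ≤ -((m₀ : ℤ) + 1)}, greenMH β t (s + latVec d ξ η m.1 n)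

/-- The doubly periodic east kernel: images of `s` under `l_{mn}` for `n = -1, 0, 1` and all
`m ≥ m₀ + 1`. -/
def K2east (m₀ : ℕ) (β d ξ η : ℝ) (t s : EuclideanSpace ℝ (Fin 2)) : ℝ :=
  ∑ n ∈ Finset.Icc (-1 : ℤ) 1,
    ∑' m : {m : ℤ // (m₀ : ℤ) + 1 ≤ m}, greenMH β t (s + latVec d ξ η m.1 n)

/-- The west integrand, as a function of the spectral variable `k`, at displacement `(X, Y)`:
with `χ = √(k² + β²)`, it is
`e^{-χ X} / (4 π χ) * e^{i k Y} * e^{-p χ d} / (1 - e^{-χ d})`. -/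
def westIntegrand (p : ℕ) (β d X Y k : ℝ) : ℂ :=
  ((Real.exp (-(√(k ^ 2 + β ^ 2) * X)) / (4 * π * √(k ^ 2 + β ^ 2)) : ℝ) : ℂ)
    * Complex.exp (Complex.I * (k : ℂ) * (Y : ℂ))
    * ((Real.exp (-((p : ℝ) * √(k ^ 2 + β ^ 2) * d))
        / (1 - Real.exp (-(√(k ^ 2 + β ^ 2) * d))) : ℝ) : ℂ)

/-- The east integrand: the west integrand with `e^{-χ X}` replaced by `e^{χ X}`. -/
def eastIntegrand (p : ℕ) (β d X Y k : ℝ) : ℂ :=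
  ((Real.exp (√(k ^ 2 + β ^ 2) * X) / (4 * π * √(k ^ 2 + β ^ 2)) : ℝ) : ℂ)
    * Complex.exp (Complex.I * (k : ℂ) * (Y : ℂ))
    * ((Real.exp (-((p : ℝ) * √(k ^ 2 + β ^ 2) * d))
        / (1 - Real.exp (-(√(k ^ 2 + β ^ 2) * d))) : ℝ) : ℂ)

end

/-!
The Green's function of a source at displacement `(A, Y)` with `A > 0` has the plane-wave expansion
`K₀(β R) / (2π) = ∫ e^{-χ A} / (4 π χ) e^{i k Y} dk`, where `R = √(A² + Y²)` and `χ = √(k² + β²)`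
(`integrable_planeWave_and_integral_eq`). In polar coordinates `A = R cos θ`, `Y = R sin θ`, the
substitution `k = β sinh u` turns the right side into `(4π)⁻¹ ∫ e^{-β R cosh (u - iθ)} du`, the
integral defining `K₀` with its line of integration moved by `-iθ`. As `A > 0`, the line stays in
the strip `|Im w| < π / 2`, where the integral does not depend on `θ`: by the Cauchy–Riemann
equation its `θ`-derivative is the integral of a `u`-derivative, which vanishes
(`integral_shiftedBesselIntegrand`).

The images in a row to the west have displacements `A = X + (p + j) d`, `j = 0, 1, 2, …`. Under the
spectral integral they form a geometric series of ratio `e^{-χ d} ≤ e^{-β d} < 1`, so sum and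
integral may be exchanged, and the sum of the series is the stated integrand
(`hasSum_besselK0_westIntegrand`). The east side is the west side with `X` replaced by `-X`. The
hypotheses on the unit cell serve only to make `A` positive for every image that is summed:
`|X| ≤ d` in the singly periodic case, and `|X - n ξ| ≤ 3 d` in the doubly periodic case.
-/

/-! ### Integrability of exponentials of hyperbolic cosines -/

theorem one_add_sq_div_two_le_cosh (u : ℝ) : 1 + u ^ 2 / 2 ≤ Real.cosh u := by
  have h1 : Real.cosh u = 1 + 2 * Real.sinh (u / 2) ^ 2 := by
    have := Real.cosh_two_mul (u / 2)
    rw [mul_div_cancel₀ u two_ne_zero] at this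
    rw [this, Real.cosh_sq]
    ring
  have h2 : |u / 2| ≤ |Real.sinh (u / 2)| := by
    rw [Real.abs_sinh]
    exact Real.self_le_sinh_iff.2 (abs_nonneg _)
  have h3 := sq_le_sq.2 h2
  linarith [h3, show (u / 2) ^ 2 = u ^ 2 / 4 by ring]

theorem integrable_exp_neg_mul_cosh {a : ℝ} (ha : 0 < a) :
    Integrable (fun u : ℝ => Real.exp (-(a * Real.cosh u))) := by
  refine (integrable_exp_neg_mul_sq (half_pos ha)).mono' (by fun_prop) (.of_forall fun u => ?_)
  rw [Real.norm_of_nonneg (Real.exp_pos _).le]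
  refine Real.exp_le_exp.2 ?_
  have := mul_le_mul_of_nonneg_left (one_add_sq_div_two_le_cosh u) ha.le
  nlinarith

theorem integrable_cosh_mul_exp_neg_mul_cosh {a : ℝ} (ha : 0 < a) :
    Integrable (fun u : ℝ => Real.cosh u * Real.exp (-(a * Real.cosh u))) := by
  refine ((integrable_exp_neg_mul_cosh (half_pos ha)).const_mul (2 / a)).mono' (by fun_prop)
    (.of_forall fun u => ?_)
  rw [Real.norm_of_nonneg (mul_nonneg (Real.cosh_pos u).le (Real.exp_pos _).le)]
  have h1 : Real.cosh u ≤ 2 / a * Real.exp (a / 2 * Real.cosh u) := by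
    rw [div_mul_eq_mul_div, le_div_iff₀ ha]
    linarith [Real.add_one_le_exp (a / 2 * Real.cosh u)]
  calc Real.cosh u * Real.exp (-(a * Real.cosh u))
      ≤ 2 / a * Real.exp (a / 2 * Real.cosh u) * Real.exp (-(a * Real.cosh u)) :=
        mul_le_mul_of_nonneg_right h1 (Real.exp_pos _).le
    _ = 2 / a * Real.exp (-(a / 2 * Real.cosh u)) := by
        rw [mul_assoc, ← Real.exp_add]; ring_nf

/-! ### Rotating the contour in the integral for `K₀` -/

/-- The Bessel integrand `e^{-z cosh w}` on the horizontal line `w = u - iθ`, where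
`cosh (u - iθ) = cosh u cos θ - i sinh u sin θ`. -/
noncomputable def shiftedBesselIntegrand (z θ u : ℝ) : ℂ :=
  Complex.exp (-((z : ℂ) * ((Real.cosh u : ℂ) * (Real.cos θ : ℂ)
    - (Real.sinh u : ℂ) * (Real.sin θ : ℂ) * Complex.I)))

theorem continuous_shiftedBesselIntegrand (z θ : ℝ) : Continuous (shiftedBesselIntegrand z θ) := by
  unfold shiftedBesselIntegrand
  fun_prop

theorem norm_shiftedBesselIntegrand (z θ u : ℝ) :
    ‖shiftedBesselIntegrand z θ u‖ = Real.exp (-(z * Real.cos θ * Real.cosh u)) := by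
  rw [shiftedBesselIntegrand, Complex.norm_exp]
  congr 1
  simp [-Complex.ofReal_cosh, -Complex.ofReal_sinh, -Complex.ofReal_cos, -Complex.ofReal_sin]
  ring

theorem integrable_shiftedBesselIntegrand {z θ : ℝ} (h : 0 < z * Real.cos θ) :
    Integrable (shiftedBesselIntegrand z θ) :=
  (integrable_exp_neg_mul_cosh h).mono' (continuous_shiftedBesselIntegrand z θ).aestronglyMeasurable
    (.of_forall fun u => (norm_shiftedBesselIntegrand z θ u).le)

/-- The derivative of `shiftedBesselIntegrand z θ u` in the direction `u`. -/
noncomputable def shiftedBesselIntegrandDeriv (z θ u : ℝ) : ℂ :=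
  shiftedBesselIntegrand z θ u * (-((z : ℂ) * ((Real.sinh u : ℂ) * (Real.cos θ : ℂ)
    - (Real.cosh u : ℂ) * (Real.sin θ : ℂ) * Complex.I)))

theorem hasDerivAt_shiftedBesselIntegrand_right (z θ u : ℝ) :
    HasDerivAt (fun v => shiftedBesselIntegrand z θ v) (shiftedBesselIntegrandDeriv z θ u) u := by
  have hc := (Real.hasDerivAt_cosh u).ofReal_comp
  have hs := (Real.hasDerivAt_sinh u).ofReal_comp
  exact ((((hc.mul_const (Real.cos θ : ℂ)).fun_sub
    ((hs.mul_const (Real.sin θ : ℂ)).mul_const Complex.I)).const_mul (z : ℂ)).fun_neg).cexp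

/-- The Cauchy–Riemann equation for `e^{-z cosh (u - iθ)}`: the `θ`-derivative is `-i` times the
`u`-derivative. -/
theorem hasDerivAt_shiftedBesselIntegrand_left (z θ u : ℝ) :
    HasDerivAt (fun φ => shiftedBesselIntegrand z φ u)
      (-Complex.I * shiftedBesselIntegrandDeriv z θ u) θ := by
  have hc := (Real.hasDerivAt_cos θ).ofReal_comp
  have hs := (Real.hasDerivAt_sin θ).ofReal_comp
  refine ((((hc.const_mul (Real.cosh u : ℂ)).fun_sub
    ((hs.const_mul (Real.sinh u : ℂ)).mul_const Complex.I)).const_mul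
    (z : ℂ)).fun_neg).cexp.congr_deriv ?_
  rw [shiftedBesselIntegrandDeriv, shiftedBesselIntegrand]
  push_cast
  linear_combination (Complex.exp (-((z : ℂ) * (Complex.cosh u * Complex.cos θ
    - Complex.sinh u * Complex.sin θ * Complex.I))) * z * Complex.cosh u * Complex.sin θ)
    * Complex.I_sq

theorem norm_shiftedBesselIntegrandDeriv_le {z θ c u : ℝ} (hz : 0 < z) (hc : c ≤ Real.cos θ) :
    ‖shiftedBesselIntegrandDeriv z θ u‖
      ≤ z * (Real.cosh u * Real.exp (-(z * c * Real.cosh u))) := by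
  -- `|sinh (u - iθ)|² = sinh² u + sin² θ ≤ cosh² u`
  have h1 : ‖(Real.sinh u : ℂ) * (Real.cos θ : ℂ)
      - (Real.cosh u : ℂ) * (Real.sin θ : ℂ) * Complex.I‖ ≤ Real.cosh u := by
    refine abs_le_of_sq_le_sq' ?_ (Real.cosh_pos u).le |>.2
    rw [← Complex.normSq_eq_norm_sq, Complex.normSq_apply]
    simp only [Complex.sub_re, Complex.sub_im, Complex.mul_re, Complex.mul_im, Complex.ofReal_re,
      Complex.ofReal_im, Complex.I_re, Complex.I_im]
    have h1 := Real.cosh_sq u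
    have h2 := Real.sin_sq_add_cos_sq θ
    have h3 : Real.sinh u ^ 2 * Real.cos θ ^ 2 + Real.cosh u ^ 2 * Real.sin θ ^ 2
        ≤ Real.cosh u ^ 2 * (Real.sin θ ^ 2 + Real.cos θ ^ 2) := by
      rw [h1]; nlinarith [sq_nonneg (Real.cos θ)]
    rw [h2] at h3
    linarith
  have h2 : Real.exp (-(z * Real.cos θ * Real.cosh u)) ≤ Real.exp (-(z * c * Real.cosh u)) := by
    have := (Real.cosh_pos u).le
    gcongr
  rw [shiftedBesselIntegrandDeriv, norm_mul, norm_neg, norm_mul, norm_shiftedBesselIntegrand,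
    Complex.norm_of_nonneg hz.le]
  calc _ ≤ Real.exp (-(z * c * Real.cosh u)) * (z * Real.cosh u) := by gcongr
    _ = _ := by ring

theorem hasDerivAt_integral_shiftedBesselIntegrand {z θ : ℝ} (hz : 0 < z) (hθ : 0 < Real.cos θ) :
    HasDerivAt (fun φ => ∫ u, shiftedBesselIntegrand z φ u) 0 θ := by
  have hs : {φ : ℝ | Real.cos θ / 2 < Real.cos φ} ∈ nhds θ :=
    (isOpen_lt continuous_const Real.continuous_cos).mem_nhds (half_lt_self hθ)
  have hmeas : AEStronglyMeasurable (fun u => -Complex.I * shiftedBesselIntegrandDeriv z θ u) := by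
    unfold shiftedBesselIntegrandDeriv shiftedBesselIntegrand
    fun_prop
  have key := hasDerivAt_integral_of_dominated_loc_of_deriv_le (μ := volume)
    (F := fun φ u => shiftedBesselIntegrand z φ u)
    (F' := fun φ u => -Complex.I * shiftedBesselIntegrandDeriv z φ u) hs
    (.of_forall fun φ => (continuous_shiftedBesselIntegrand z φ).aestronglyMeasurable)
    (integrable_shiftedBesselIntegrand (mul_pos hz hθ)) hmeas
    (.of_forall fun u φ hφ => by
      rw [norm_mul, norm_neg, Complex.norm_I, one_mul]
      exact norm_shiftedBesselIntegrandDeriv_le hz hφ.le)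
    ((integrable_cosh_mul_exp_neg_mul_cosh (mul_pos hz (half_pos hθ))).const_mul z)
    (.of_forall fun u φ _ => hasDerivAt_shiftedBesselIntegrand_left z φ u)
  have hint : Integrable (fun u => shiftedBesselIntegrandDeriv z θ u) := by
    refine (key.1.const_mul Complex.I).congr (.of_forall fun u => ?_)
    simp [← mul_assoc]
  -- The `θ`-derivative is a multiple of a `u`-derivative, so it integrates to zero over the line.
  have hzero := integral_eq_zero_of_hasDerivAt_of_integrable
    (hasDerivAt_shiftedBesselIntegrand_right z θ) hint
    (integrable_shiftedBesselIntegrand (mul_pos hz hθ))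
  simpa only [integral_const_mul, hzero, mul_zero] using key.2

theorem integral_shiftedBesselIntegrand_zero (z : ℝ) :
    ∫ u, shiftedBesselIntegrand z 0 u = ((2 * besselK0 z : ℝ) : ℂ) := by
  have h := integral_comp_abs (f := fun u => Real.exp (-(z * Real.cosh u)))
  simp only [Real.cosh_abs] at h
  rw [besselK0, ← h, ← integral_complex_ofReal]
  exact integral_congr_ae (.of_forall fun u => by simp [shiftedBesselIntegrand])

/-- Moving the line of integration within the strip `|Im w| < π / 2` leaves `K₀` unchanged. -/
theorem integral_shiftedBesselIntegrand {z θ : ℝ} (hz : 0 < z) (hθ : |θ| < π / 2) :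
    ∫ u, shiftedBesselIntegrand z θ u = ((2 * besselK0 z : ℝ) : ℂ) := by
  have hd (φ : ℝ) (hφ : φ ∈ Set.Ioo (-(π / 2)) (π / 2)) :=
    hasDerivAt_integral_shiftedBesselIntegrand hz (Real.cos_pos_of_mem_Ioo hφ)
  rw [← integral_shiftedBesselIntegrand_zero]
  exact isOpen_Ioo.is_const_of_deriv_eq_zero isPreconnected_Ioo
    (fun φ hφ => (hd φ hφ).differentiableAt.differentiableWithinAt)
    (fun φ hφ => (hd φ hφ).deriv) (abs_lt.1 hθ)
    ⟨by linarith [Real.pi_pos], by linarith [Real.pi_pos]⟩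

/-! ### The plane-wave expansion of the Green's function -/

/-- The spectral integrand of a single source at displacement `(A, Y)`, `A > 0`: with
`χ = √(k² + β²)`, it is `e^{-χ A} / (4 π χ) * e^{i k Y}`. -/
noncomputable def planeWave (β A Y k : ℝ) : ℂ :=
  ((Real.exp (-(√(k ^ 2 + β ^ 2) * A)) / (4 * π * √(k ^ 2 + β ^ 2)) : ℝ) : ℂ)
    * Complex.exp (Complex.I * (k : ℂ) * (Y : ℂ))

/-- The substitution `k = β sinh u` turns the plane-wave integrand into the Bessel integrand on
the line `Im w = -θ`, where `θ` is the polar angle of the displacement. -/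
theorem jacobian_smul_planeWave {β : ℝ} (hβ : 0 < β) (R θ u : ℝ) :
    |β * Real.cosh u| • planeWave β (R * Real.cos θ) (R * Real.sin θ) (β * Real.sinh u)
      = ((1 / (4 * π) : ℝ) : ℂ) * shiftedBesselIntegrand (β * R) θ u := by
  have hpos : 0 < β * Real.cosh u := mul_pos hβ (Real.cosh_pos u)
  have hsq : √((β * Real.sinh u) ^ 2 + β ^ 2) = β * Real.cosh u := by
    rw [show (β * Real.sinh u) ^ 2 + β ^ 2 = (β * Real.cosh u) ^ 2 by
      rw [mul_pow, mul_pow, Real.cosh_sq]; ring, Real.sqrt_sq hpos.le]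
  rw [planeWave, hsq, abs_of_pos hpos, Complex.real_smul, ← mul_assoc, ← Complex.ofReal_mul,
    show β * Real.cosh u * (Real.exp (-(β * Real.cosh u * (R * Real.cos θ)))
        / (4 * π * (β * Real.cosh u)))
      = 1 / (4 * π) * Real.exp (-(β * Real.cosh u * (R * Real.cos θ))) by
      have := hpos.ne'
      field_simp,
    Complex.ofReal_mul, mul_assoc, Complex.ofReal_exp, ← Complex.exp_add, shiftedBesselIntegrand]
  congr 2
  push_cast
  ring

theorem image_mul_sinh_univ {β : ℝ} (hβ : 0 < β) :
    (fun u => β * Real.sinh u) '' Set.univ = Set.univ := by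
  rw [Set.image_univ]
  refine Set.range_eq_univ.2 fun k => ?_
  obtain ⟨u, hu⟩ := Real.sinh_surjective (k / β)
  exact ⟨u, by simp only [hu]; field_simp⟩

/-- The Fourier representation of the Green's function in the half-plane `A > 0`:
`K₀(β R) / (2π) = ∫ e^{-χ A} / (4 π χ) e^{i k Y} dk` with `R = √(A² + Y²)`. -/
theorem integrable_planeWave_and_integral_eq {β A : ℝ} (hβ : 0 < β) (hA : 0 < A) (Y : ℝ) :
    Integrable (planeWave β A Y) ∧
      ∫ k, planeWave β A Y k = ((1 / (2 * π) * besselK0 (β * √(A ^ 2 + Y ^ 2)) : ℝ) : ℂ) := by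
  -- Polar coordinates `A = R cos θ`, `Y = R sin θ`; the angle lies in `(-π/2, π/2)` as `A > 0`.
  obtain ⟨R, θ, hR, hθ, rfl, rfl⟩ :
      ∃ R θ : ℝ, 0 < R ∧ |θ| < π / 2 ∧ A = R * Real.cos θ ∧ Y = R * Real.sin θ := by
    refine ⟨‖(⟨A, Y⟩ : ℂ)‖, Complex.arg ⟨A, Y⟩, norm_pos_iff.2 fun h => ?_,
      Complex.abs_arg_lt_pi_div_two_iff.2 (Or.inl hA), ?_, ?_⟩
    · exact hA.ne' (congrArg Complex.re h)
    · rw [Complex.norm_mul_cos_arg]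
    · rw [Complex.norm_mul_sin_arg]
  have hcos : 0 < Real.cos θ := Real.cos_pos_of_mem_Ioo (abs_lt.1 hθ)
  have hderiv : ∀ u ∈ Set.univ, HasDerivWithinAt (fun u => β * Real.sinh u)
      (β * Real.cosh u) Set.univ u :=
    fun u _ => ((Real.hasDerivAt_sinh u).const_mul β).hasDerivWithinAt
  have hinj : Set.InjOn (fun u => β * Real.sinh u) Set.univ :=
    fun u _ v _ h => Real.sinh_injective (mul_left_cancel₀ hβ.ne' h)
  have hsqrt : √((R * Real.cos θ) ^ 2 + (R * Real.sin θ) ^ 2) = R := by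
    rw [show (R * Real.cos θ) ^ 2 + (R * Real.sin θ) ^ 2
      = R ^ 2 * (Real.sin θ ^ 2 + Real.cos θ ^ 2) by ring, Real.sin_sq_add_cos_sq, mul_one,
      Real.sqrt_sq hR.le]
  constructor
  · have h := integrableOn_image_iff_integrableOn_abs_deriv_smul MeasurableSet.univ hderiv hinj
      (planeWave β (R * Real.cos θ) (R * Real.sin θ))
    rw [image_mul_sinh_univ hβ, integrableOn_univ, integrableOn_univ] at h
    rw [h]
    simp only [jacobian_smul_planeWave hβ]
    exact (integrable_shiftedBesselIntegrand (by positivity)).const_mul _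
  · have h := integral_image_eq_integral_abs_deriv_smul MeasurableSet.univ hderiv hinj
      (planeWave β (R * Real.cos θ) (R * Real.sin θ))
    rw [image_mul_sinh_univ hβ, setIntegral_univ, setIntegral_univ] at h
    simp only [h, jacobian_smul_planeWave hβ]
    rw [integral_const_mul, integral_shiftedBesselIntegrand (mul_pos hβ hR) hθ, hsqrt,
      ← Complex.ofReal_mul]
    congr 1
    field_simp
    norm_num

/-! ### Summing over a half-line of images -/

theorem norm_planeWave (β A Y k : ℝ) :
    ‖planeWave β A Y k‖
      = Real.exp (-(√(k ^ 2 + β ^ 2) * A)) / (4 * π * √(k ^ 2 + β ^ 2)) := by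
  rw [planeWave, norm_mul, Complex.norm_of_nonneg (by positivity), Complex.norm_exp]
  simp

theorem le_sqrt_sq_add_sq (β k : ℝ) : β ≤ √(k ^ 2 + β ^ 2) :=
  Real.le_sqrt_of_sq_le (by nlinarith [sq_nonneg k])

theorem planeWave_add_mul (β A d Y k : ℝ) (j : ℕ) :
    planeWave β (A + j * d) Y k
      = planeWave β A Y k * ((Real.exp (-(√(k ^ 2 + β ^ 2) * d)) : ℝ) : ℂ) ^ j := by
  have h : Real.exp (-(√(k ^ 2 + β ^ 2) * (A + j * d)))
      = Real.exp (-(√(k ^ 2 + β ^ 2) * A)) * Real.exp (-(√(k ^ 2 + β ^ 2) * d)) ^ j := by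
    rw [← Real.exp_nat_mul, ← Real.exp_add]; ring_nf
  rw [planeWave, planeWave, h]
  push_cast
  ring

theorem westIntegrand_eq_planeWave_div (p : ℕ) (β d X Y k : ℝ) :
    westIntegrand p β d X Y k = planeWave β (X + p * d) Y k
      * (1 - ((Real.exp (-(√(k ^ 2 + β ^ 2) * d)) : ℝ) : ℂ))⁻¹ := by
  have h : Real.exp (-(√(k ^ 2 + β ^ 2) * (X + p * d)))
      = Real.exp (-(√(k ^ 2 + β ^ 2) * X)) * Real.exp (-((p : ℝ) * √(k ^ 2 + β ^ 2) * d)) := by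
    rw [← Real.exp_add]; ring_nf
  rw [westIntegrand, planeWave, h]
  push_cast
  ring

theorem eastIntegrand_eq_westIntegrand_neg (p : ℕ) (β d X Y k : ℝ) :
    eastIntegrand p β d X Y k = westIntegrand p β d (-X) Y k := by
  simp [eastIntegrand, westIntegrand]

theorem exp_neg_sqrt_mul_le (β : ℝ) {d : ℝ} (hd : 0 < d) (k : ℝ) :
    Real.exp (-(√(k ^ 2 + β ^ 2) * d)) ≤ Real.exp (-(β * d)) := by
  have := le_sqrt_sq_add_sq β k
  gcongr

theorem integrable_westIntegrand {p : ℕ} {β d X : ℝ} (hβ : 0 < β) (hd : 0 < d)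
    (hX : 0 < X + p * d) (Y : ℝ) : Integrable (westIntegrand p β d X Y) := by
  have hq : Real.exp (-(β * d)) < 1 := Real.exp_lt_one_iff.2 (neg_neg_of_pos (mul_pos hβ hd))
  simp only [funext (westIntegrand_eq_planeWave_div p β d X Y)]
  refine (integrable_planeWave_and_integral_eq hβ hX Y).1.mul_bdd
    (c := (1 - Real.exp (-(β * d)))⁻¹) (by fun_prop) (.of_forall fun k => ?_)
  have := exp_neg_sqrt_mul_le β hd k
  rw [norm_inv, ← Complex.ofReal_one, ← Complex.ofReal_sub, Complex.norm_of_nonneg (by linarith)]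
  exact inv_anti₀ (by linarith) (by linarith)

/-- The images at abscissae `X + (p + j) d`, `j ≥ 0`, contribute a geometric series of ratio
`e^{-χ d} ≤ e^{-β d} < 1` under the spectral integral. -/
theorem hasSum_besselK0_westIntegrand {p : ℕ} {β d X : ℝ} (hβ : 0 < β) (hd : 0 < d)
    (hX : 0 < X + p * d) (Y : ℝ) :
    HasSum (fun j : ℕ =>
        ((1 / (2 * π) * besselK0 (β * √((X + p * d + j * d) ^ 2 + Y ^ 2)) : ℝ) : ℂ))
      (∫ k, westIntegrand p β d X Y k) := by
  have hq : Real.exp (-(β * d)) < 1 := Real.exp_lt_one_iff.2 (neg_neg_of_pos (mul_pos hβ hd))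
  have hpos (j : ℕ) : 0 < X + p * d + j * d := by positivity
  have hint (j : ℕ) := (integrable_planeWave_and_integral_eq hβ (hpos j) Y).1
  have hint0 := (integrable_planeWave_and_integral_eq hβ hX Y).1
  have hnorm (j : ℕ) : ∫ k, ‖planeWave β (X + p * d + j * d) Y k‖
      ≤ (∫ k, ‖planeWave β (X + p * d) Y k‖) * Real.exp (-(β * d)) ^ j := by
    rw [← integral_mul_const]
    refine integral_mono (hint j).norm (hint0.norm.mul_const _) fun k => ?_
    simp only [planeWave_add_mul β (X + p * d), norm_mul, norm_pow,
      Complex.norm_of_nonneg (Real.exp_pos _).le]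
    have := exp_neg_sqrt_mul_le β hd k
    gcongr
  have hsum : Summable fun j : ℕ => ∫ k, ‖planeWave β (X + p * d + j * d) Y k‖ :=
    Summable.of_nonneg_of_le (fun j => integral_nonneg fun k => norm_nonneg _) hnorm
      ((summable_geometric_of_lt_one (Real.exp_pos _).le hq).mul_left _)
  have h := hasSum_integral_of_summable_integral_norm hint hsum
  have htsum (k : ℝ) : ∑' j : ℕ, planeWave β (X + p * d + j * d) Y k
      = westIntegrand p β d X Y k := by
    have hlt : ‖((Real.exp (-(√(k ^ 2 + β ^ 2) * d)) : ℝ) : ℂ)‖ < 1 := by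
      rw [Complex.norm_of_nonneg (Real.exp_pos _).le]
      exact (exp_neg_sqrt_mul_le β hd k).trans_lt hq
    simp only [planeWave_add_mul β (X + p * d)]
    rw [tsum_mul_left, tsum_geometric_of_norm_lt_one hlt, westIntegrand_eq_planeWave_div]
  simp only [htsum, fun j => (integrable_planeWave_and_integral_eq hβ (hpos j) Y).2] at h
  exact h

/-- `j ↦ -(m₀ + 1) - j` enumerates the integers `m ≤ -(m₀ + 1)`. -/
def natEquivWest (m₀ : ℕ) : ℕ ≃ {m : ℤ // m ≤ -((m₀ : ℤ) + 1)} where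
  toFun j := ⟨-((m₀ : ℤ) + 1) - j, by omega⟩
  invFun m := (-((m₀ : ℤ) + 1) - m.1).toNat
  left_inv j := by simp
  right_inv m := by
    have := m.2
    ext
    simp only
    omega

/-- `j ↦ m₀ + 1 + j` enumerates the integers `m ≥ m₀ + 1`. -/
def natEquivEast (m₀ : ℕ) : ℕ ≃ {m : ℤ // (m₀ : ℤ) + 1 ≤ m} where
  toFun j := ⟨(m₀ : ℤ) + 1 + j, by omega⟩
  invFun m := (m.1 - ((m₀ : ℤ) + 1)).toNat
  left_inv j := by simp
  right_inv m := by
    have := m.2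
    ext
    simp only
    omega

theorem greenMH_add_latVec (β d ξ η : ℝ) (t s : EuclideanSpace ℝ (Fin 2)) (m n : ℤ) :
    greenMH β t (s + latVec d ξ η m n) = 1 / (2 * π) * besselK0 (β *
      √((t 0 - s 0 - n * ξ - m * d) ^ 2 + (t 1 - s 1 - n * η) ^ 2)) := by
  rw [greenMH, EuclideanSpace.norm_eq]
  simp only [latVec, latE1, latE2, Fin.sum_univ_two, Real.norm_eq_abs, sq_abs, PiLp.sub_apply,
    PiLp.add_apply, PiLp.smul_apply, smul_eq_mul, Matrix.cons_val_zero,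
    Matrix.cons_val_one]
  ring_nf

theorem hasSum_greenMH_west (m₀ : ℕ) {β d ξ η : ℝ} {t s : EuclideanSpace ℝ (Fin 2)} {n : ℤ}
    (hβ : 0 < β) (hd : 0 < d) (hX : 0 < t 0 - s 0 - n * ξ + (m₀ + 1 : ℕ) * d) :
    HasSum (fun m : {m : ℤ // m ≤ -((m₀ : ℤ) + 1)} =>
        ((greenMH β t (s + latVec d ξ η m.1 n) : ℝ) : ℂ))
      (∫ k, westIntegrand (m₀ + 1) β d (t 0 - s 0 - n * ξ) (t 1 - s 1 - n * η) k) := by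
  rw [← (natEquivWest m₀).hasSum_iff]
  convert hasSum_besselK0_westIntegrand hβ hd hX (t 1 - s 1 - n * η) using 2 with j
  rw [Function.comp_apply, greenMH_add_latVec]
  simp only [natEquivWest, Equiv.coe_fn_mk]
  push_cast
  ring_nf

theorem hasSum_greenMH_east (m₀ : ℕ) {β d ξ η : ℝ} {t s : EuclideanSpace ℝ (Fin 2)} {n : ℤ}
    (hβ : 0 < β) (hd : 0 < d) (hX : 0 < -(t 0 - s 0 - n * ξ) + (m₀ + 1 : ℕ) * d) :
    HasSum (fun m : {m : ℤ // (m₀ : ℤ) + 1 ≤ m} =>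
        ((greenMH β t (s + latVec d ξ η m.1 n) : ℝ) : ℂ))
      (∫ k, eastIntegrand (m₀ + 1) β d (t 0 - s 0 - n * ξ) (t 1 - s 1 - n * η) k) := by
  simp only [eastIntegrand_eq_westIntegrand_neg]
  rw [← (natEquivEast m₀).hasSum_iff]
  convert hasSum_besselK0_westIntegrand hβ hd hX (t 1 - s 1 - n * η) using 2 with j
  rw [Function.comp_apply, greenMH_add_latVec]
  simp only [natEquivEast, Equiv.coe_fn_mk]
  push_cast
  ring_nf

theorem integrable_eastIntegrand {p : ℕ} {β d X : ℝ} (hβ : 0 < β) (hd : 0 < d)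
    (hX : 0 < -X + p * d) (Y : ℝ) : Integrable (eastIntegrand p β d X Y) := by
  rw [funext (eastIntegrand_eq_westIntegrand_neg p β d X Y)]
  exact integrable_westIntegrand hβ hd hX Y

/-! ### Separation of the unit cell from its far images -/

theorem abs_sub_apply_zero_le_of_mem_unitCell {d ξ η : ℝ} {t s : EuclideanSpace ℝ (Fin 2)}
    (hd : 0 < d) (ht : t ∈ unitCell d ξ η) (hs : s ∈ unitCell d ξ η) :
    |t 0 - s 0| ≤ d + |ξ| := by
  obtain ⟨a, ha, b, hb, rfl⟩ := ht
  obtain ⟨a', ha', b', hb', rfl⟩ := hs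
  have h : (a • latE1 d + b • latE2 ξ η) 0 - (a' • latE1 d + b' • latE2 ξ η) 0
      = (a - a') * d + (b - b') * ξ := by
    simp only [latE1, latE2, PiLp.add_apply, PiLp.smul_apply, smul_eq_mul,
      Matrix.cons_val_zero]
    ring
  have h1 : |a - a'| ≤ 1 := abs_le.2 ⟨by linarith [ha.1, ha'.2], by linarith [ha.2, ha'.1]⟩
  have h2 : |b - b'| ≤ 1 := abs_le.2 ⟨by linarith [hb.1, hb'.2], by linarith [hb.2, hb'.1]⟩
  rw [h]
  refine (abs_add_le _ _).trans ?_
  rw [abs_mul, abs_mul, abs_of_pos hd]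
  have := mul_le_mul_of_nonneg_right h1 hd.le
  have := mul_le_mul_of_nonneg_right h2 (abs_nonneg ξ)
  linarith

/-- Since `|ξ| ≤ d`, the horizontal displacements relative to the shifted cells `n = -1, 0, 1` are at
most `3 d`; hence the images with `m ≤ -4` lie strictly west and those with `m ≥ 4` strictly east,
as the plane-wave expansion requires. -/
theorem abs_sub_sub_mul_le_of_mem_unitCell {d ξ η : ℝ} {t s : EuclideanSpace ℝ (Fin 2)} {n : ℤ}
    (hd : 0 < d) (hξ : √(ξ ^ 2 + η ^ 2) ≤ d) (ht : t ∈ unitCell d ξ η) (hs : s ∈ unitCell d ξ η)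
    (hn : n ∈ Finset.Icc (-1 : ℤ) 1) : |t 0 - s 0 - n * ξ| ≤ 3 * d := by
  have h1 := abs_sub_apply_zero_le_of_mem_unitCell hd ht hs
  have h2 : |ξ| ≤ d := (Real.abs_le_sqrt (by nlinarith [sq_nonneg η])).trans hξ
  have h3 : |(n : ℝ)| ≤ 1 := by
    rw [Finset.mem_Icc] at hn
    exact abs_le.2 ⟨by exact_mod_cast hn.1, by exact_mod_cast hn.2⟩
  have h4 : |(n : ℝ) * ξ| ≤ |ξ| := by
    rw [abs_mul]
    exact mul_le_of_le_one_left (abs_nonneg ξ) h3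
  linarith [abs_sub (t 0 - s 0) ((n : ℝ) * ξ)]

theorem mainTheorem2 (β d η : ℝ) (hβ : 0 < β) (hd : 0 < d) (hη : 0 < η) :
    -- the singly periodic case, on the rectangular cell of dimension `d × η`
    (∀ t ∈ unitCell d 0 η, ∀ s ∈ unitCell d 0 η,
      (Summable (fun m : {m : ℤ // m ≤ -(((1 : ℕ) : ℤ) + 1)} =>
          greenMH β t (s + (m.1 : ℝ) • latE1 d)) ∧
        Integrable (fun k : ℝ => westIntegrand 2 β d (t 0 - s 0) (t 1 - s 1) k) volume ∧
        (K1west 1 β d t s : ℂ) = ∫ k : ℝ, westIntegrand 2 β d (t 0 - s 0) (t 1 - s 1) k) ∧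
      (Summable (fun m : {m : ℤ // ((1 : ℕ) : ℤ) + 1 ≤ m} =>
          greenMH β t (s + (m.1 : ℝ) • latE1 d)) ∧
        Integrable (fun k : ℝ => eastIntegrand 2 β d (t 0 - s 0) (t 1 - s 1) k) volume ∧
        (K1east 1 β d t s : ℂ) = ∫ k : ℝ, eastIntegrand 2 β d (t 0 - s 0) (t 1 - s 1) k)) ∧
    -- the doubly periodic case, on the parallelogram spanned by `⟨d, 0⟩` and `⟨ξ, η⟩`
    (∀ ξ : ℝ, √(ξ ^ 2 + η ^ 2) ≤ d → ∀ t ∈ unitCell d ξ η, ∀ s ∈ unitCell d ξ η,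
      ((∀ n ∈ Finset.Icc (-1 : ℤ) 1,
          Summable (fun m : {m : ℤ // m ≤ -(((3 : ℕ) : ℤ) + 1)} =>
            greenMH β t (s + latVec d ξ η m.1 n)) ∧
          Integrable (fun k : ℝ =>
            westIntegrand 4 β d (t 0 - s 0 - n * ξ) (t 1 - s 1 - n * η) k) volume) ∧
        (K2west 3 β d ξ η t s : ℂ) = ∑ n ∈ Finset.Icc (-1 : ℤ) 1,
          ∫ k : ℝ, westIntegrand 4 β d (t 0 - s 0 - n * ξ) (t 1 - s 1 - n * η) k) ∧
      ((∀ n ∈ Finset.Icc (-1 : ℤ) 1,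
          Summable (fun m : {m : ℤ // ((3 : ℕ) : ℤ) + 1 ≤ m} =>
            greenMH β t (s + latVec d ξ η m.1 n)) ∧
          Integrable (fun k : ℝ =>
            eastIntegrand 4 β d (t 0 - s 0 - n * ξ) (t 1 - s 1 - n * η) k) volume) ∧
        (K2east 3 β d ξ η t s : ℂ) = ∑ n ∈ Finset.Icc (-1 : ℤ) 1,
          ∫ k : ℝ, eastIntegrand 4 β d (t 0 - s 0 - n * ξ) (t 1 - s 1 - n * η) k)) := by
  constructor
  · intro t ht s hs
    have hX := abs_le.1 (abs_sub_apply_zero_le_of_mem_unitCell hd ht hs)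
    rw [abs_zero, add_zero] at hX
    have hvec (m : ℤ) : (m : ℝ) • latE1 d = latVec d 0 η m 0 := by simp [latVec]
    have hw : 0 < t 0 - s 0 + (2 : ℕ) * d := by push_cast; linarith [hX.1]
    have he : 0 < -(t 0 - s 0) + (2 : ℕ) * d := by push_cast; linarith [hX.2]
    have hW := hasSum_greenMH_west 1 (ξ := 0) (η := η) (t := t) (s := s) (n := 0) hβ hd
      (by simpa using hw)
    have hE := hasSum_greenMH_east 1 (ξ := 0) (η := η) (t := t) (s := s) (n := 0) hβ hd
      (by simpa using he)
    simp only [Int.cast_zero, zero_mul, sub_zero, ← hvec] at hW hE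
    refine ⟨⟨Complex.summable_ofReal.1 hW.summable, integrable_westIntegrand hβ hd hw _, ?_⟩,
      Complex.summable_ofReal.1 hE.summable, integrable_eastIntegrand hβ hd he _, ?_⟩
    · rw [K1west, Complex.ofReal_tsum]
      exact hW.tsum_eq
    · rw [K1east, Complex.ofReal_tsum]
      exact hE.tsum_eq
  · intro ξ hξ t ht s hs
    have hX (n : ℤ) (hn : n ∈ Finset.Icc (-1 : ℤ) 1) :=
      abs_le.1 (abs_sub_sub_mul_le_of_mem_unitCell hd hξ ht hs hn)
    have hw (n : ℤ) (hn : n ∈ Finset.Icc (-1 : ℤ) 1) :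
        0 < t 0 - s 0 - n * ξ + (4 : ℕ) * d := by push_cast; linarith [(hX n hn).1]
    have he (n : ℤ) (hn : n ∈ Finset.Icc (-1 : ℤ) 1) :
        0 < -(t 0 - s 0 - n * ξ) + (4 : ℕ) * d := by push_cast; linarith [(hX n hn).2]
    have hW (n : ℤ) (hn : n ∈ Finset.Icc (-1 : ℤ) 1) :=
      hasSum_greenMH_west 3 (η := η) hβ hd (hw n hn)
    have hE (n : ℤ) (hn : n ∈ Finset.Icc (-1 : ℤ) 1) :=
      hasSum_greenMH_east 3 (η := η) hβ hd (he n hn)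
    refine ⟨⟨fun n hn => ⟨Complex.summable_ofReal.1 (hW n hn).summable,
        integrable_westIntegrand hβ hd (hw n hn) _⟩, ?_⟩,
      fun n hn => ⟨Complex.summable_ofReal.1 (hE n hn).summable,
        integrable_eastIntegrand hβ hd (he n hn) _⟩, ?_⟩
    · rw [K2west, Complex.ofReal_sum]
      refine Finset.sum_congr rfl fun n hn => ?_
      rw [Complex.ofReal_tsum]
      exact (hW n hn).tsum_eq
    · rw [K2east, Complex.ofReal_sum]
      refine Finset.sum_congr rfl fun n hn => ?_
      rw [Complex.ofReal_tsum]
      exact (hE n hn).tsum_eq
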